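/- Let $X$ be an Archimedean (real) vector lattice with the projection property, i.e. every band in $X$ is a projection band, and let $X^\delta$ be its order (Dedekind) completion, i.e. an order complete vector lattice containing $X$ as an order dense and majorizing sublattice. A net $(x_\alpha)$ in a vector lattice $E$ converges uniformly to $x\in E$ if there is $e\in E_+$ such that for every $\varepsilon>0$ there is $\alpha_0$ with $|x_\alpha-x|\le\varepsilon e$ for all $\alpha\ge\alpha_0$; it is uniformly Cauchy if the double net $(x_\alpha-x_\beta)_{(\alpha,\beta)}$ converges uniformly to $0$; $E$ is uniformly complete if every uniformly Cauchy net in $E$ converges uniformly in $E$. Let $\overline{X}^{1}$ be the uniform adherence of $X$ in $X^\delta$, i.e. the set of all limits in $X^\delta$ of uniformly convergent (in $X^\delta$) nets of elements of $X$; let $\overline{X}$ be the uniform closure of $X$ in $X^\delta$, i.e. the intersection of all subsets of $X^\delta$ that contain $X$ and contain the limits of all nets in them that converge uniformly in $X^\delta$; and let $X^{\rm ru}$ be the uniform completion of $X$, i.e. the intersection of all sublattices of $X^\delta$ that contain $X$ and are, as vector lattices in their own right, uniformly complete. Then $$\overline{X}^{1}=\overline{X}=X^\delta.$$ In particular, $X^{\rm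 ru}=X^\delta$. -/

import Mathlib

open scoped NNReal

universe u v

namespace VecLat

/-! ### Vector lattices

A vector lattice is a real vector space `E` with a lattice order compatible with the linear
structure, i.e. `[AddCommGroup E] [Lattice E] [IsOrderedAddMonoid E] [Module ℝ E]
[IsOrderedModule ℝ E]`. -/

/-- The Archimedean property of a vector lattice: if `n x ≤ y` for all `n ∈ ℕ`, then `x ≤ 0`. -/
def IsArchimedean (E : Type u) [AddCommGroup E] [Lattice E] [Module ℝ E] : Prop :=
  ∀ x y : E, (∀ n : ℕ, (n : ℝ) • x ≤ y) → x ≤ 0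

/-- Order (Dedekind) completeness: every non-empty set that is bounded above has a supremum. -/
def IsOrderComplete (E : Type u) [Lattice E] : Prop :=
  ∀ S : Set E, S.Nonempty → BddAbove S → ∃ s, IsLUB S s

/-! ### Bands and the projection property -/

section Bands

variable {E : Type u} [AddCommGroup E] [Lattice E] [Module ℝ E]

/-- An (order) ideal: a solid linear subspace. -/
def IsIdeal (B : Submodule ℝ E) : Prop :=
  ∀ ⦃x y : E⦄, y ∈ B → |x| ≤ |y| → x ∈ B

/-- A band: an ideal that contains the supremum of each of its subsets that has a supremum
in the whole space. -/
def IsBand (B : Submodule ℝ E) : Prop :=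
  IsIdeal B ∧ ∀ (S : Set E) (x : E), S ⊆ B → IsLUB S x → x ∈ B

/-- The disjoint complement of a set. -/
def disjointComplement (A : Set E) : Set E :=
  {z | ∀ a ∈ A, |z| ⊓ |a| = 0}

/-- A projection band: a band `B` such that `E = B + Bᵈ` (the sum is automatically direct,
since an element of `B ∩ Bᵈ` is disjoint from itself). -/
def IsProjectionBand (B : Submodule ℝ E) : Prop :=
  IsBand B ∧ ∀ x : E, ∃ y ∈ B, ∃ z ∈ disjointComplement (B : Set E), x = y + z

/-- The projection property (PP): every band is a projection band. -/
def HasProjectionProperty (E : Type u) [AddCommGroup E] [Lattice E] [Module ℝ E] : Prop :=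
  ∀ B : Submodule ℝ E, IsBand B → IsProjectionBand B

end Bands

/-! ### Uniform convergence -/

section Uniform

variable {E : Type u} [AddCommGroup E] [Lattice E] [Module ℝ E]

/-- The net `f` converges to `x` uniformly relative to the regulator `e`. -/
def UConvergesRel {I : Type v} [Preorder I] (e : E) (f : I → E) (x : E) : Prop :=
  ∀ ε : ℝ, 0 < ε → ∃ i₀ : I, ∀ i, i₀ ≤ i → |f i - x| ≤ ε • e

/-- The net `f` converges to `x` (relatively) uniformly in `E`. -/
def UConverges {I : Type v} [Preorder I] (f : I → E) (x : E) : Prop :=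
  ∃ e : E, 0 ≤ e ∧ UConvergesRel e f x

/-- The net `f` is uniformly Cauchy in `E`: the net `(f i - f j)`, indexed by `I × I`,
converges uniformly to `0`. -/
def UCauchy {I : Type v} [Preorder I] (f : I → E) : Prop :=
  UConverges (fun p : I × I => f p.1 - f p.2) 0

/-- The uniform adherence of `A` in `E`: all limits in `E` of uniformly convergent nets
in `A`. -/
def uniformAdherence (A : Set E) : Set E :=
  {x | ∃ (I : Type u) (_ : Preorder I) (_ : IsDirectedOrder I) (_ : Nonempty I) (f : I → E),
    (∀ i, f i ∈ A) ∧ UConverges f x}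

/-- In the uniform adherence, sequences suffice. -/
theorem mem_uniformAdherence_iff_seq [IsOrderedModule ℝ E] {A : Set E} {x : E} :
    x ∈ uniformAdherence A ↔ ∃ f : ℕ → E, (∀ n, f n ∈ A) ∧ UConverges f x := by
  constructor
  · rintro ⟨I, _, _, _, f, hf, e, he, h⟩
    choose i hi using fun n : ℕ => h (1 / (n + 1 : ℝ)) Nat.one_div_pos_of_nat
    refine ⟨fun n => f (i n), fun n => hf _, e, he, fun ε hε => ?_⟩
    obtain ⟨N, hN⟩ := exists_nat_one_div_lt hε
    refine ⟨N, fun n hn => (hi n _ le_rfl).trans (smul_le_smul_of_nonneg_right ?_ he)⟩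
    exact (Nat.one_div_le_one_div hn).trans hN.le
  · rintro ⟨f, hf, e, he, h⟩
    refine ⟨ULift ℕ, inferInstance, ⟨fun a b => ⟨a ⊔ b, le_sup_left, le_sup_right⟩⟩, inferInstance,
      fun n => f n.down, fun n => hf _, e, he, fun ε hε => ?_⟩
    obtain ⟨N, hN⟩ := h ε hε
    exact ⟨⟨N⟩, fun n hn => hN _ hn⟩

/-- `A` is uniformly closed in `E`: it contains the limits of all uniformly convergent nets
in `A`. -/
def IsUniformlyClosed (A : Set E) : Prop :=
  ∀ (I : Type u) [Preorder I] [IsDirectedOrder I] [Nonempty I] (f : I → E) (x : E),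
    (∀ i, f i ∈ A) → UConverges f x → x ∈ A

/-- The uniform closure of `A` in `E`: the intersection of all uniformly closed subsets
of `E` that contain `A`. -/
def uniformClosure (A : Set E) : Set E :=
  ⋂₀ {C | IsUniformlyClosed C ∧ A ⊆ C}

/-- Uniform completeness: every uniformly Cauchy net in `E` converges uniformly in `E`. -/
def IsUniformlyComplete (E : Type u) [AddCommGroup E] [Lattice E] [Module ℝ E] : Prop :=
  ∀ (I : Type u) [Preorder I] [IsDirectedOrder I] [Nonempty I] (f : I → E),
    UCauchy f → ∃ x : E, UConverges f x

end Uniform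

/-! ### Sublattices -/

/-- A sublattice of a vector lattice: a linear subspace closed under `⊔` and `⊓`. -/
structure VectorSublattice (E : Type u) [AddCommGroup E] [Lattice E] [Module ℝ E] extends
    Submodule ℝ E where
  sup_mem' : ∀ {x y : E}, x ∈ carrier → y ∈ carrier → x ⊔ y ∈ carrier
  inf_mem' : ∀ {x y : E}, x ∈ carrier → y ∈ carrier → x ⊓ y ∈ carrier

namespace VectorSublattice

variable {E : Type u} [AddCommGroup E] [Lattice E] [Module ℝ E]

instance : SetLike (VectorSublattice E) E where
  coe Y := Y.carrier
  coe_injective := by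
    rintro ⟨p, _, _⟩ ⟨q, _, _⟩ h
    have : p = q := SetLike.coe_injective h
    subst this
    rfl

instance : AddSubgroupClass (VectorSublattice E) E where
  add_mem {Y} _ _ hx hy := Y.toSubmodule.add_mem hx hy
  zero_mem Y := Y.toSubmodule.zero_mem
  neg_mem {Y} _ hx := Y.toSubmodule.neg_mem hx

instance : SMulMemClass (VectorSublattice E) ℝ E where
  smul_mem {Y} c _ hx := Y.toSubmodule.smul_mem c hx

/-- A sublattice is itself a vector lattice, with the inherited order and operations. -/
instance (Y : VectorSublattice E) : Lattice Y :=
  Subtype.lattice (fun _ _ hx hy => Y.sup_mem' hx hy) (fun _ _ hx hy => Y.inf_mem' hx hy)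

end VectorSublattice

/-! ### Order completion and uniform completion -/

/-- The vector lattice `D`, together with the embedding `J : X → D`, is an order (Dedekind)
completion of `X`: `D` is order complete and `J` is an isomorphism of vector lattices from `X`
onto an order dense and majorizing sublattice of `D`. Such a pair exists for every Archimedean `X`
(see `exists_isOrderCompletion`) and is unique up to isomorphism. -/
structure IsOrderCompletion {X : Type u} {D : Type v}
    [AddCommGroup X] [Lattice X] [Module ℝ X] [AddCommGroup D] [Lattice D] [Module ℝ D]
    (J : X →ₗ[ℝ] D) : Prop where
  orderComplete : IsOrderComplete D
  injective : Function.Injective J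
  map_sup : ∀ x y : X, J (x ⊔ y) = J x ⊔ J y
  map_inf : ∀ x y : X, J (x ⊓ y) = J x ⊓ J y
  orderDense : ∀ d : D, 0 < d → ∃ x : X, 0 < J x ∧ J x ≤ d
  majorizing : ∀ d : D, 0 ≤ d → ∃ x : X, d ≤ J x

/-- For an order completion `J : X → D`, the uniform completion of `X`: the intersection of all
those sublattices of `D` that contain (the image of) `X` and are uniformly complete as vector
lattices in their own right. -/
def uniformCompletion {X : Type u} {D : Type v}
    [AddCommGroup X] [Lattice X] [Module ℝ X] [AddCommGroup D] [Lattice D] [Module ℝ D]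
    (J : X →ₗ[ℝ] D) : Set D :=
  ⋂₀ {C | ∃ Y : VectorSublattice D, IsUniformlyComplete Y ∧ Set.range J ⊆ Y ∧ C = Y}

/-! ### Existence of the order completion, by bounded cuts -/

/-- A bounded cut of `X`: a non-empty bounded above set that contains all lower bounds of the set
of its upper bounds. -/
@[ext]
structure BddCut (X : Type u) [Lattice X] where
  L : Set X
  closed : lowerBounds (upperBounds L) ⊆ L
  nonempty : L.Nonempty
  bdd : BddAbove L

namespace BddCut

section Order

variable {X : Type u} [Lattice X]

instance : PartialOrder (BddCut X) where
  le A B := A.L ⊆ B.L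
  le_refl _ := subset_rfl
  le_trans _ _ _ h h' := h.trans h'
  le_antisymm _ _ h h' := BddCut.ext (h.antisymm h')

theorem le_def {A B : BddCut X} : A ≤ B ↔ A.L ⊆ B.L := Iff.rfl

theorem lower (A : BddCut X) {x y : X} (h : x ≤ y) (hy : y ∈ A.L) : x ∈ A.L :=
  A.closed fun _ hz => h.trans (hz hy)

theorem sup_mem (A : BddCut X) {x y : X} (hx : x ∈ A.L) (hy : y ∈ A.L) : x ⊔ y ∈ A.L :=
  A.closed fun _ hz => sup_le (hz hx) (hz hy)

/-- The least cut that contains a given non-empty bounded above set. -/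
def gen (S : Set X) (hS : S.Nonempty) (hb : BddAbove S) : BddCut X where
  L := lowerBounds (upperBounds S)
  closed := fun _ hx _ hz => hx fun _ ha => ha hz
  nonempty := hS.mono fun _ hx _ hz => hz hx
  bdd := hb.imp fun _ hz _ hx => hx hz

theorem gen_map {S : Set X} {hS hb} (e : X ≃o X) {C : BddCut X} (h : ∀ x ∈ S, e x ∈ C.L) {x : X}
    (hx : x ∈ (gen S hS hb).L) : e x ∈ C.L := by
  refine C.closed fun w hw => ?_
  rw [← e.le_symm_apply]
  refine hx fun s hs => ?_
  rw [e.le_symm_apply]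
  exact hw (h s hs)

theorem gen_le {S : Set X} {hS hb} {C : BddCut X} : gen S hS hb ≤ C ↔ ∀ x ∈ S, x ∈ C.L :=
  ⟨fun h x hx => h fun _ hz => hz hx, fun h _ hx => gen_map (OrderIso.refl X) h hx⟩

/-- The principal cut of an element. -/
def of (x : X) : BddCut X where
  L := Set.Iic x
  closed := fun _ hy => hy fun _ hz => hz
  nonempty := ⟨x, le_refl x⟩
  bdd := ⟨x, fun _ hz => hz⟩

theorem of_le {x : X} {A : BddCut X} : of x ≤ A ↔ x ∈ A.L :=
  ⟨fun h => h (le_refl x), fun h _ hy => A.lower hy h⟩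

theorem le_of {x : X} {A : BddCut X} : A ≤ of x ↔ ∀ a ∈ A.L, a ≤ x := Iff.rfl

instance : Lattice (BddCut X) where
  sup A B := gen (A.L ∪ B.L) A.nonempty.inl (A.bdd.union B.bdd)
  le_sup_left A B := fun _ hx _ hz => hz (Or.inl hx)
  le_sup_right A B := fun _ hx _ hz => hz (Or.inr hx)
  sup_le A B C h h' := gen_le.2 fun x hx => hx.elim (fun hx => h hx) (fun hx => h' hx)
  inf A B :=
    { L := A.L ∩ B.L
      closed := fun _ hx =>
        ⟨A.closed fun _ hz => hx fun _ hy => hz hy.1, B.closed fun _ hz => hx fun _ hy => hz hy.2⟩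
      nonempty := by
        obtain ⟨a, ha⟩ := A.nonempty
        obtain ⟨b, hb⟩ := B.nonempty
        exact ⟨a ⊓ b, A.lower inf_le_left ha, B.lower inf_le_right hb⟩
      bdd := A.bdd.mono Set.inter_subset_left }
  inf_le_left A B := fun _ hx => hx.1
  inf_le_right A B := fun _ hx => hx.2
  le_inf A B C h h' := fun _ hx => ⟨h hx, h' hx⟩

theorem isOrderComplete : IsOrderComplete (BddCut X) := by
  rintro S ⟨A, hA⟩ ⟨B, hB⟩
  refine ⟨gen (⋃ C ∈ S, C.L) ?_ ?_, ?_, ?_⟩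
  · exact A.nonempty.mono (Set.subset_biUnion_of_mem (u := fun C : BddCut X => C.L) hA)
  · exact B.bdd.mono (Set.iUnion₂_subset fun C hC => hB hC)
  · exact fun C hC x hx z hz => hz (Set.mem_biUnion (t := fun C : BddCut X => C.L) hC hx)
  · intro C hC
    rw [gen_le]
    intro x hx
    obtain ⟨F, hF, hx⟩ := Set.mem_iUnion₂.1 hx
    exact hC hF hx

theorem of_sup (x y : X) : of (x ⊔ y) = of x ⊔ of y :=
  eq_of_forall_ge_iff fun C => by
    rw [sup_le_iff, of_le, of_le, of_le]
    exact ⟨fun h => ⟨C.lower le_sup_left h, C.lower le_sup_right h⟩, fun h => C.sup_mem h.1 h.2⟩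

theorem of_inf (x y : X) : of (x ⊓ y) = of x ⊓ of y :=
  BddCut.ext Set.Iic_inter_Iic.symm

end Order

section Group

variable {X : Type u} [AddCommGroup X] [Lattice X] [IsOrderedAddMonoid X]

instance : Zero (BddCut X) := ⟨of 0⟩

instance : Add (BddCut X) where
  add A B := gen (Set.image2 (· + ·) A.L B.L) (A.nonempty.image2 B.nonempty) (by
    obtain ⟨a, ha⟩ := A.bdd
    obtain ⟨b, hb⟩ := B.bdd
    refine ⟨a + b, ?_⟩
    rintro _ ⟨x, hx, y, hy, rfl⟩
    exact add_le_add (ha hx) (hb hy))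

instance : Neg (BddCut X) where
  neg A :=
    { L := {x | -x ∈ upperBounds A.L}
      closed := by
        intro x hx a ha
        refine le_neg.1 (hx fun y hy => ?_)
        exact le_neg.1 (hy ha)
      nonempty := by
        obtain ⟨b, hb⟩ := A.bdd
        exact ⟨-b, by simpa using hb⟩
      bdd := by
        obtain ⟨a, ha⟩ := A.nonempty
        exact ⟨-a, fun x hx => le_neg.1 (hx ha)⟩ }

theorem add_le {A B C : BddCut X} : A + B ≤ C ↔ ∀ a ∈ A.L, ∀ b ∈ B.L, a + b ∈ C.L := by
  refine gen_le.trans ⟨fun h a ha b hb => h _ ⟨a, ha, b, hb, rfl⟩, ?_⟩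
  rintro h _ ⟨a, ha, b, hb, rfl⟩
  exact h a ha b hb

theorem add_comm' (A B : BddCut X) : A + B = B + A :=
  eq_of_forall_ge_iff fun C => by
    rw [add_le, add_le]
    exact ⟨fun h a ha b hb => add_comm b a ▸ h b hb a ha,
      fun h a ha b hb => add_comm b a ▸ h b hb a ha⟩

theorem add_add_le {A B C D : BddCut X} :
    A + B + C ≤ D ↔ ∀ a ∈ A.L, ∀ b ∈ B.L, ∀ c ∈ C.L, a + b + c ∈ D.L := by
  rw [add_le]
  constructor
  · intro h a ha b hb c hc
    exact h _ (add_le.1 le_rfl a ha b hb) c hc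
  · intro h x hx c hc
    refine gen_map (OrderIso.addRight c) ?_ hx
    rintro _ ⟨a, ha, b, hb, rfl⟩
    exact h a ha b hb c hc

theorem add_assoc' (A B C : BddCut X) : A + B + C = A + (B + C) :=
  eq_of_forall_ge_iff fun D => by
    rw [add_comm' A (B + C), add_add_le, add_add_le]
    constructor
    · intro h b hb c hc a ha
      rw [show b + c + a = a + b + c by abel]
      exact h a ha b hb c hc
    · intro h a ha b hb c hc
      rw [show a + b + c = b + c + a by abel]
      exact h b hb c hc a ha

theorem zero_add' (A : BddCut X) : 0 + A = A :=
  eq_of_forall_ge_iff fun C => by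
    rw [add_le, le_def]
    constructor
    · intro h a ha
      simpa using h 0 (le_refl (0 : X)) a ha
    · intro h a ha b hb
      exact C.lower (add_le_of_nonpos_left ha) (h hb)

theorem neg_add_cancel' [Module ℝ X] (hX : IsArchimedean X) (A : BddCut X) : -A + A = 0 := by
  apply le_antisymm
  · rw [add_le]
    intro r hr a ha
    exact (add_le_add_right (hr ha) r).trans (add_neg_cancel r).le
  · refine of_le.2 ?_
    intro w hw
    have hw' : ∀ a ∈ A.L, ∀ z ∈ upperBounds A.L, a - z ≤ w := by
      intro a ha z hz
      refine hw ⟨-z, ?_, a, ha, ?_⟩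
      · simpa [Neg.neg] using hz
      · show -z + a = a - z
        abel
    have step : ∀ a ∈ A.L, a + (-w ⊔ 0) ∈ A.L := by
      intro a ha
      refine A.closed fun z hz => ?_
      have h1 : -w ⊔ 0 ≤ z - a := by
        refine sup_le ?_ (sub_nonneg.2 (hz ha))
        rw [neg_le, neg_sub]
        exact hw' a ha z hz
      calc a + (-w ⊔ 0) ≤ a + (z - a) := add_le_add_right h1 a
        _ = z := by abel
    obtain ⟨a, ha⟩ := A.nonempty
    obtain ⟨z, hz⟩ := A.bdd
    have hn : ∀ n : ℕ, a + n • (-w ⊔ 0) ∈ A.L := by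
      intro n
      induction n with
      | zero => simpa using ha
      | succ k ih =>
        rw [succ_nsmul, ← add_assoc]
        exact step _ ih
    have h0 : -w ⊔ 0 ≤ 0 := by
      refine hX _ (z - a) fun n => ?_
      rw [Nat.cast_smul_eq_nsmul ℝ, le_sub_iff_add_le, add_comm]
      exact hz (hn n)
    exact neg_nonpos.1 (le_sup_left.trans h0)

/-- The additive group of bounded cuts of an Archimedean vector lattice. -/
@[reducible]
def addCommGroup [Module ℝ X] (hX : IsArchimedean X) : AddCommGroup (BddCut X) where
  add_assoc := add_assoc'
  zero_add := zero_add'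
  add_zero A := (add_comm' A 0).trans (zero_add' A)
  add_comm := add_comm'
  neg_add_cancel := neg_add_cancel' hX
  nsmul := nsmulRec
  zsmul := zsmulRec

theorem of_add (x y : X) : of (x + y) = of x + of y :=
  eq_of_forall_ge_iff fun C => by
    rw [of_le, add_le]
    exact ⟨fun h a ha b hb => C.lower (add_le_add ha hb) h,
      fun h => h x (le_refl x) y (le_refl y)⟩

end Group

section Scalar

variable {X : Type u} [AddCommGroup X] [Lattice X] [IsOrderedAddMonoid X] [Module ℝ X]
  [IsOrderedModule ℝ X]

/-- Multiplication of a cut by a non-negative scalar. -/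
def nnsmul (c : ℝ≥0) (A : BddCut X) : BddCut X :=
  gen ((fun x => (c : ℝ) • x) '' A.L) (A.nonempty.image _) (by
    obtain ⟨a, ha⟩ := A.bdd
    refine ⟨(c : ℝ) • a, ?_⟩
    rintro _ ⟨x, hx, rfl⟩
    exact smul_le_smul_of_nonneg_left (ha hx) c.2)

theorem nnsmul_le {c : ℝ≥0} {A C : BddCut X} : nnsmul c A ≤ C ↔ ∀ a ∈ A.L, (c : ℝ) • a ∈ C.L := by
  refine gen_le.trans ⟨fun h a ha => h _ ⟨a, ha, rfl⟩, ?_⟩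
  rintro h _ ⟨a, ha, rfl⟩
  exact h a ha

theorem gen_smul {S : Set X} {hS hb} {C : BddCut X} {c : ℝ≥0} :
    (∀ x ∈ (gen S hS hb).L, (c : ℝ) • x ∈ C.L) ↔ ∀ x ∈ S, (c : ℝ) • x ∈ C.L := by
  refine ⟨fun h x hx => h x fun _ hz => hz hx, fun h x hx => ?_⟩
  rcases eq_or_lt_of_le c.2 with h0 | h0
  · obtain ⟨s, hs⟩ := hS
    have := h s hs
    simp only [NNReal.val_eq_coe] at h0
    rw [← h0, zero_smul] at this ⊢
    exact this
  · exact gen_map (OrderIso.smulRight (β := X) h0) h hx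

theorem nnsmul_one (A : BddCut X) : nnsmul 1 A = A :=
  eq_of_forall_ge_iff fun C => by
    rw [nnsmul_le, le_def]
    simp [Set.subset_def]

theorem nnsmul_zero (A : BddCut X) : nnsmul 0 A = 0 :=
  eq_of_forall_ge_iff fun C => by
    rw [nnsmul_le]
    refine Iff.trans ?_ (of_le (x := (0 : X))).symm
    obtain ⟨a, ha⟩ := A.nonempty
    exact ⟨fun h => by simpa using h a ha, fun h _ _ => by simpa using h⟩

theorem nnsmul_nnsmul (c d : ℝ≥0) (A : BddCut X) : nnsmul c (nnsmul d A) = nnsmul (c * d) A :=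
  eq_of_forall_ge_iff fun C => by
    rw [nnsmul_le, nnsmul_le]
    refine gen_smul.trans ?_
    simp [mul_smul]

theorem nnsmul_add (c : ℝ≥0) (A B : BddCut X) : nnsmul c (A + B) = nnsmul c A + nnsmul c B := by
  apply le_antisymm
  · rw [nnsmul_le]
    refine gen_smul.2 ?_
    rintro _ ⟨a, ha, b, hb, rfl⟩
    show (c : ℝ) • (a + b) ∈ _
    rw [smul_add]
    exact add_le.1 le_rfl _ (nnsmul_le.1 le_rfl a ha) _ (nnsmul_le.1 le_rfl b hb)
  · rw [add_le]
    have key : ∀ a ∈ A.L, ∀ b ∈ B.L, (c : ℝ) • a + (c : ℝ) • b ∈ (nnsmul c (A + B)).L := by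
      intro a ha b hb
      rw [← smul_add]
      exact nnsmul_le.1 le_rfl _ (add_le.1 le_rfl a ha b hb)
    intro x hx y hy
    refine gen_map (OrderIso.addRight y) ?_ hx
    rintro _ ⟨a, ha, rfl⟩
    refine gen_map (OrderIso.addLeft ((c : ℝ) • a)) ?_ hy
    rintro _ ⟨b, hb, rfl⟩
    exact key a ha b hb

theorem add_nnsmul (c d : ℝ≥0) (A : BddCut X) : nnsmul (c + d) A = nnsmul c A + nnsmul d A := by
  apply le_antisymm
  · rw [nnsmul_le]
    intro a ha
    rw [NNReal.coe_add, add_smul]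
    exact add_le.1 le_rfl _ (nnsmul_le.1 le_rfl a ha) _ (nnsmul_le.1 le_rfl a ha)
  · rw [add_le]
    intro x hx y hy
    refine gen_map (OrderIso.addRight y) ?_ hx
    rintro _ ⟨a, ha, rfl⟩
    refine gen_map (OrderIso.addLeft ((c : ℝ) • a)) ?_ hy
    rintro _ ⟨b, hb, rfl⟩
    show (c : ℝ) • a + (d : ℝ) • b ∈ _
    refine BddCut.lower _ ?_ (nnsmul_le.1 le_rfl _ (A.sup_mem ha hb))
    rw [NNReal.coe_add, add_smul]
    exact add_le_add (smul_le_smul_of_nonneg_left le_sup_left c.2)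
      (smul_le_smul_of_nonneg_left le_sup_right d.2)

theorem of_nnsmul (c : ℝ≥0) (x : X) : of ((c : ℝ) • x) = nnsmul c (of x) :=
  eq_of_forall_ge_iff fun C => by
    rw [of_le, nnsmul_le]
    exact ⟨fun h a ha => C.lower (smul_le_smul_of_nonneg_left ha c.2) h, fun h => h x (le_refl x)⟩

theorem nnsmul_mono (c : ℝ≥0) {A B : BddCut X} (h : A ≤ B) : nnsmul c A ≤ nnsmul c B :=
  nnsmul_le.2 fun a ha => nnsmul_le.1 le_rfl a (h ha)

instance : SMul ℝ (BddCut X) where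
  smul c A := nnsmul c.toNNReal A + -nnsmul (-c).toNNReal A

theorem smul_eq (hX : IsArchimedean X) {c : ℝ} {p q : ℝ≥0} (h : c = p - q) (A : BddCut X) :
    c • A = nnsmul p A + -nnsmul q A := by
  let _ := addCommGroup hX
  have e : c.toNNReal + q = p + (-c).toNNReal := by
    apply NNReal.coe_injective
    push_cast
    rw [Real.coe_toNNReal', Real.coe_toNNReal']
    rcases le_total 0 c with hc | hc
    · rw [max_eq_left hc, max_eq_right (by linarith)]; linarith
    · rw [max_eq_right hc, max_eq_left (by linarith)]; linarith
  have e' := congrArg (fun t => nnsmul t A) e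
  simp only [add_nnsmul] at e'
  show nnsmul c.toNNReal A + -nnsmul (-c).toNNReal A = _
  rw [← sub_eq_add_neg, ← sub_eq_add_neg, sub_eq_sub_iff_add_eq_add]
  exact e'

theorem nnsmul_neg (hX : IsArchimedean X) (c : ℝ≥0) (A : BddCut X) :
    nnsmul c (-A) = -nnsmul c A := by
  let _ := addCommGroup hX
  rw [eq_neg_iff_add_eq_zero, ← nnsmul_add, neg_add_cancel]
  refine (of_nnsmul c (0 : X)).symm.trans ?_
  rw [smul_zero]
  rfl

theorem exists_sub (c : ℝ) : ∃ p q : ℝ≥0, c = p - q :=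
  ⟨c.toNNReal, (-c).toNNReal, by
    rw [Real.coe_toNNReal', Real.coe_toNNReal', max_zero_sub_max_neg_zero_eq_self]⟩

/-- The vector space of bounded cuts of an Archimedean vector lattice. -/
@[reducible]
def module (hX : IsArchimedean X) : @Module ℝ (BddCut X) _ (addCommGroup hX).toAddCommMonoid := by
  letI := addCommGroup hX
  refine Module.ofMinimalAxioms ?_ ?_ ?_ ?_
  · intro c A B
    obtain ⟨p, q, h⟩ := exists_sub c
    rw [smul_eq hX h, smul_eq hX h, smul_eq hX h, nnsmul_add, nnsmul_add]
    abel
  · intro c d A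
    obtain ⟨p, q, h⟩ := exists_sub c
    obtain ⟨r, s, h'⟩ := exists_sub d
    rw [smul_eq hX h, smul_eq hX h', smul_eq hX (p := p + r) (q := q + s)
      (by push_cast; rw [h, h']; ring), add_nnsmul, add_nnsmul]
    abel
  · intro c d A
    obtain ⟨p, q, h⟩ := exists_sub c
    obtain ⟨r, s, h'⟩ := exists_sub d
    rw [smul_eq hX (p := p * r + q * s) (q := p * s + q * r) (by push_cast; rw [h, h']; ring),
      smul_eq hX h, smul_eq hX h']
    simp only [add_nnsmul, nnsmul_add, nnsmul_neg hX, nnsmul_nnsmul]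
    abel
  · intro A
    rw [smul_eq hX (p := 1) (q := 0) (by simp), nnsmul_one, nnsmul_zero, neg_zero, add_zero]

end Scalar

end BddCut

/-- Every Archimedean vector lattice has an order completion. -/
theorem exists_isOrderCompletion (X : Type u) [AddCommGroup X] [Lattice X] [IsOrderedAddMonoid X]
    [Module ℝ X] [IsOrderedModule ℝ X] (hX : IsArchimedean X) :
    ∃ (D : Type u) (_ : AddCommGroup D) (_ : Lattice D) (_ : IsOrderedAddMonoid D)
      (_ : Module ℝ D) (_ : IsOrderedModule ℝ D) (J : X →ₗ[ℝ] D), IsOrderCompletion J := by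
  let i1 := BddCut.addCommGroup hX
  let i2 := BddCut.module hX
  have i3 : IsOrderedAddMonoid (BddCut X) :=
    { add_le_add_left := fun A B h C =>
        BddCut.add_le.2 fun a ha c hc => BddCut.add_le.1 le_rfl a (h ha) c hc }
  have hs : ∀ (c : ℝ) (hc : 0 ≤ c) (A : BddCut X), c • A = BddCut.nnsmul ⟨c, hc⟩ A := by
    intro c hc A
    rw [BddCut.smul_eq hX (p := ⟨c, hc⟩) (q := 0) (sub_zero c).symm, BddCut.nnsmul_zero, neg_zero,
      add_zero]
  have i4 : PosSMulMono ℝ (BddCut X) := ⟨fun c hc A B h => by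
    show c • A ≤ c • B
    rw [hs c hc, hs c hc]
    exact BddCut.nnsmul_mono _ h⟩
  have i5 : SMulPosMono ℝ (BddCut X) := ⟨fun A hA c d h => by
    show c • A ≤ d • A
    rw [← sub_nonneg, ← sub_smul]
    exact smul_nonneg (sub_nonneg.2 h) hA⟩
  refine ⟨BddCut X, i1, inferInstance, i3, i2, { },
    { toFun := BddCut.of
      map_add' := BddCut.of_add
      map_smul' := ?_ }, BddCut.isOrderComplete, ?_, BddCut.of_sup, BddCut.of_inf, ?_, ?_⟩
  · intro c x
    obtain ⟨p, q, h⟩ := BddCut.exists_sub c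
    have h1 : BddCut.of (c • x) + BddCut.of ((q : ℝ) • x) = BddCut.of ((p : ℝ) • x) := by
      rw [← BddCut.of_add, ← add_smul, h, sub_add_cancel]
    rw [BddCut.of_nnsmul, BddCut.of_nnsmul] at h1
    rw [RingHom.id_apply, BddCut.smul_eq hX h, ← h1]
    abel
  · intro x y h
    exact le_antisymm (BddCut.of_le.1 (le_of_eq h)) (BddCut.of_le.1 (le_of_eq h.symm))
  · intro A hA
    have h0 : (0 : X) ∈ A.L := BddCut.of_le.1 hA.le
    obtain ⟨a, ha, hna⟩ : ∃ a ∈ A.L, ¬ a ≤ 0 := by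
      by_contra! hcon
      exact hA.not_ge (BddCut.le_of.2 hcon)
    refine ⟨a ⊔ 0, ?_, BddCut.of_le.2 (A.sup_mem ha h0)⟩
    refine lt_of_le_not_ge (BddCut.of_le.2 (le_sup_right (a := a) (b := (0 : X)))) fun hle => ?_
    exact hna (le_sup_left.trans (BddCut.of_le.1 hle))
  · rintro A -
    obtain ⟨b, hb⟩ := A.bdd
    exact ⟨b, fun a ha => hb ha⟩

end VecLat

namespace VecLat

/-! ### Disjointness in lattice-ordered groups -/

section LatticeOrderedGroup

variable {E : Type u} [AddCommGroup E] [Lattice E] [IsOrderedAddMonoid E]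

/-! Elements of the completion have binary expansions whose partial sums lie in `X`. Let `0 ≤ d ≤ J
u`. The projection property splits `u = p + q` so that, heuristically, `2d ≥ J u` on `p` and `2d ≤ J
u` on `q` (`exists_split`). Then `J p` is the first binary digit of `d` relative to `J u`: the
remainder `2d - J p` lies again in `[0, J u]` (`exists_two_smul_sub_mem_Icc`). After `n` digits the
error is at most `2⁻ⁿ J u` (`exists_sub_mem_Icc`), so `d` is a uniform limit with regulator `J u`. A
translation by a majorant from `X` reduces every `d` to this case, so the adherence is already
everything, and hence so is the closure.

For the uniform completion, a net in `X` that converges uniformly in `D` may be given a regulator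
from `X`. It is then Cauchy inside every sublattice containing `X`. If that sublattice is uniformly
complete, it contains a limit, which is the original one because `D` is Archimedean. -/

/-- Disjointness turns `t + a` into `t ⊔ a`, and both `t` and `a` are below `a + b`; cancel `a`. -/
theorem le_of_le_add_of_inf_eq_zero {t a b : E} (hb : 0 ≤ b) (h : t ≤ a + b) (hta : t ⊓ a = 0) :
    t ≤ b := by
  have h1 : t + a = t ⊔ a := by rw [← inf_add_sup t a, hta, zero_add]
  have h2 : t + a ≤ b + a :=
    h1.trans_le (sup_le (h.trans_eq (add_comm a b)) (le_add_of_nonneg_left hb))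
  exact le_of_add_le_add_right h2

theorem add_inf_eq_zero {a b c : E} (ha : 0 ≤ a) (hb : 0 ≤ b) (hac : a ⊓ c = 0) (hbc : b ⊓ c = 0) :
    (a + b) ⊓ c = 0 := by
  have hc : 0 ≤ c := hac ▸ inf_le_right
  have ht : 0 ≤ (a + b) ⊓ c := le_inf (add_nonneg ha hb) hc
  refine le_antisymm ?_ ht
  rw [← hbc]
  refine le_inf (le_of_le_add_of_inf_eq_zero hb inf_le_left ?_) inf_le_right
  exact le_antisymm ((le_inf inf_le_right (inf_le_left.trans inf_le_right)).trans_eq hac)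
    (le_inf ht ha)

/-- Since `-p ≤ q`, the element `-p` lies below both `|p|` and `|q|`. This makes the band components
of a positive element positive. -/
theorem nonneg_of_disjoint_of_add_nonneg {p q : E} (h : |p| ⊓ |q| = 0) (hpq : 0 ≤ p + q) :
    0 ≤ p := by
  have h1 : -p ≤ |p| ⊓ |q| :=
    le_inf (neg_le_abs p) ((neg_le_iff_add_nonneg'.2 hpq).trans (le_abs_self q))
  exact neg_nonpos.1 (h1.trans_eq h)

end LatticeOrderedGroup

/-! ### Disjoint complements are bands -/

section DisjointComplement

variable {E : Type u} [AddCommGroup E] [Lattice E] [IsOrderedAddMonoid E]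

theorem mem_disjointComplement_of_abs_le {A : Set E} {x y : E} (hy : y ∈ disjointComplement A)
    (h : |x| ≤ |y|) : x ∈ disjointComplement A := fun a ha =>
  le_antisymm ((inf_le_inf_right _ h).trans_eq (hy a ha)) (le_inf (abs_nonneg x) (abs_nonneg a))

theorem zero_mem_disjointComplement (A : Set E) : (0 : E) ∈ disjointComplement A := fun a _ => by
  rw [abs_zero]
  exact inf_eq_left.2 (abs_nonneg a)

theorem add_mem_disjointComplement {A : Set E} {x y : E} (hx : x ∈ disjointComplement A)
    (hy : y ∈ disjointComplement A) : x + y ∈ disjointComplement A := fun a ha =>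
  le_antisymm
    ((inf_le_inf_right _ (abs_add_le x y)).trans_eq
      (add_inf_eq_zero (abs_nonneg x) (abs_nonneg y) (hx a ha) (hy a ha)))
    (le_inf (abs_nonneg _) (abs_nonneg a))

theorem isLUB_mem_disjointComplement {A S : Set E} {x : E} (hS : S ⊆ disjointComplement A)
    (hx : IsLUB S x) : x ∈ disjointComplement A := by
  rcases S.eq_empty_or_nonempty with rfl | ⟨s₀, hs₀⟩
  -- A least upper bound of the empty set is a least element; comparing it with `0` and `x + x`
  -- forces `x = 0`.
  · have hbot : ∀ y : E, x ≤ y := fun y => hx.2 (by simp)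
    have h1 : x ≤ 0 := hbot 0
    have h2 : x ≤ x + x := hbot (x + x)
    rw [le_antisymm h1 (le_add_iff_nonneg_left x |>.1 h2)]
    exact zero_mem_disjointComplement A
  · intro a ha
    have hpos : x⁺ ⊓ |a| = 0 := by
      -- The right-hand side is still an upper bound of `S`: each `s⁺` is disjoint from `x⁺ ⊓ |a|`,
      -- so their sum is their supremum, which is at most `x⁺`.
      have key : x⁺ ≤ x⁺ - x⁺ ⊓ |a| := by
        have hsub : 0 ≤ x⁺ - x⁺ ⊓ |a| := sub_nonneg.2 inf_le_left
        refine sup_le (hx.2 fun s hs => ?_) hsub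
        have ht : 0 ≤ x⁺ ⊓ |a| := le_inf (posPart_nonneg x) (abs_nonneg a)
        have hd : s⁺ ⊓ (x⁺ ⊓ |a|) = 0 := by
          refine le_antisymm ?_ (le_inf (posPart_nonneg s) ht)
          rw [← hS hs a ha]
          exact le_inf (inf_le_left.trans (sup_le (le_abs_self s) (abs_nonneg s)))
            (inf_le_right.trans inf_le_right)
        have hsum : s⁺ + x⁺ ⊓ |a| = s⁺ ⊔ x⁺ ⊓ |a| := by
          rw [← inf_add_sup s⁺ (x⁺ ⊓ |a|), hd, zero_add]
        rw [le_sub_iff_add_le]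
        calc s + x⁺ ⊓ |a| ≤ s⁺ + x⁺ ⊓ |a| := add_le_add_left (le_posPart s) _
          _ = s⁺ ⊔ x⁺ ⊓ |a| := hsum
          _ ≤ x⁺ := sup_le (posPart_mono (hx.1 hs)) inf_le_left
      exact le_antisymm (by simpa using key) (le_inf (posPart_nonneg x) (abs_nonneg a))
    -- One element suffices here: `s₀ ≤ x` gives `x⁻ ≤ |s₀|`.
    have hneg : x⁻ ⊓ |a| = 0 := by
      refine le_antisymm ?_ (le_inf (negPart_nonneg x) (abs_nonneg a))
      rw [← hS hs₀ a ha]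
      refine inf_le_inf_right _ (sup_le ?_ (abs_nonneg s₀))
      exact (neg_le_neg (hx.1 hs₀)).trans (neg_le_abs s₀)
    rw [← posPart_add_negPart x]
    exact add_inf_eq_zero (posPart_nonneg x) (negPart_nonneg x) hpos hneg

variable [Module ℝ E] [IsOrderedModule ℝ E]

theorem abs_smul_le_of_abs_le {c r : ℝ} (h : |c| ≤ r) (x : E) : |c • x| ≤ r • |x| := by
  have hcr := abs_le.1 h
  have e : ∀ d : ℝ, d ≤ r → -r ≤ d → d • x ≤ r • |x| := by
    intro d h1 h2
    rcases le_total 0 d with h0 | h0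
    · exact (smul_le_smul_of_nonneg_left (le_abs_self x) h0).trans
        (smul_le_smul_of_nonneg_right h1 (abs_nonneg x))
    · rw [← neg_smul_neg]
      exact (smul_le_smul_of_nonneg_left (neg_le_abs x) (neg_nonneg.2 h0)).trans
        (smul_le_smul_of_nonneg_right (neg_le.1 h2) (abs_nonneg x))
  refine sup_le (e c hcr.2 hcr.1) ?_
  rw [← neg_smul]
  exact e (-c) (neg_le.1 hcr.1) (neg_le_neg hcr.2)

/-- The disjoint complement of a set, as a linear subspace. -/
def disjointComplementSubmodule (A : Set E) : Submodule ℝ E where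
  carrier := disjointComplement A
  zero_mem' := zero_mem_disjointComplement A
  add_mem' := add_mem_disjointComplement
  smul_mem' := by
    intro c x hx
    -- Natural multiples of `|x|` are handled by additivity; solidity then covers every real scalar.
    obtain ⟨n, hn⟩ := exists_nat_ge |c|
    have hmem : ∀ k : ℕ, (k : ℝ) • |x| ∈ disjointComplement A := by
      intro k
      induction k with
      | zero => simpa using zero_mem_disjointComplement A
      | succ k ih =>
        rw [Nat.cast_succ, add_smul, one_smul]
        exact add_mem_disjointComplement ih
          (mem_disjointComplement_of_abs_le hx (abs_abs x).le)
    exact mem_disjointComplement_of_abs_le (hmem n)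
      ((abs_smul_le_of_abs_le hn x).trans (le_abs_self _))

theorem isBand_disjointComplementSubmodule (A : Set E) :
    IsBand (disjointComplementSubmodule A) :=
  ⟨fun _ _ hy h => mem_disjointComplement_of_abs_le hy h,
    fun _ _ hS hx => isLUB_mem_disjointComplement hS hx⟩

end DisjointComplement

/-! ### Uniform limits and the Archimedean property -/

section UniformLimits

variable {E : Type u} [AddCommGroup E] [Lattice E] [IsOrderedAddMonoid E] [Module ℝ E]
  [IsOrderedModule ℝ E]

theorem IsOrderComplete.isArchimedean (hE : IsOrderComplete E) : IsArchimedean E := by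
  intro x y h
  obtain ⟨s, hs⟩ := hE (Set.range fun n : ℕ => (n : ℝ) • x) (Set.range_nonempty _)
    ⟨y, by rintro _ ⟨n, rfl⟩; exact h n⟩
  -- The multiples of `x` are stable under adding `x`, so `s - x` also bounds them.
  have h1 : s ≤ s - x := hs.2 <| by
    rintro _ ⟨n, rfl⟩
    refine le_sub_iff_add_le.2 ?_
    have := hs.1 ⟨n + 1, rfl⟩
    simpa [add_smul] using this
  simpa using h1

theorem IsArchimedean.eq_zero_of_abs_le (hE : IsArchimedean E) {x e : E}
    (h : ∀ ε : ℝ, 0 < ε → |x| ≤ ε • e) : x = 0 := by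
  have he : 0 ≤ e := (abs_nonneg x).trans ((h 1 one_pos).trans_eq (one_smul ℝ e))
  suffices hx : |x| ≤ 0 from
    le_antisymm ((le_abs_self x).trans hx) (neg_nonpos.1 ((neg_le_abs x).trans hx))
  refine hE _ e fun n => ?_
  rcases n.eq_zero_or_pos with rfl | hn
  · simpa using he
  · have hn' : (0 : ℝ) < n := Nat.cast_pos.2 hn
    have := smul_le_smul_of_nonneg_left (h (n : ℝ)⁻¹ (inv_pos.2 hn')) hn'.le
    rwa [smul_inv_smul₀ hn'.ne'] at this

theorem UConverges.unique (hE : IsArchimedean E) {I : Type v} [Preorder I] [IsDirectedOrder I]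
    [Nonempty I] {f : I → E} {x y : E} (hx : UConverges f x) (hy : UConverges f y) : x = y := by
  obtain ⟨e, -, hx⟩ := hx
  obtain ⟨e', -, hy⟩ := hy
  refine sub_eq_zero.1 (hE.eq_zero_of_abs_le (e := e + e') fun ε hε => ?_)
  obtain ⟨i, hi⟩ := hx ε hε
  obtain ⟨j, hj⟩ := hy ε hε
  obtain ⟨k, hik, hjk⟩ := exists_ge_ge i j
  calc |x - y| = |(f k - y) - (f k - x)| := by rw [sub_sub_sub_cancel_left]
    _ ≤ |f k - y| + |f k - x| := by
      rw [sub_eq_add_neg, ← abs_neg (f k - x)]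
      exact abs_add_le _ _
    _ ≤ ε • e' + ε • e := add_le_add (hj k hjk) (hi k hik)
    _ = ε • (e + e') := by rw [smul_add, add_comm]

theorem UConvergesRel.mono {I : Type v} [Preorder I] {e e' : E} {f : I → E} {x : E}
    (h : UConvergesRel e f x) (he : e ≤ e') : UConvergesRel e' f x := fun ε hε =>
  (h ε hε).imp fun _ hi i hij => (hi i hij).trans (smul_le_smul_of_nonneg_left he hε.le)

theorem UConvergesRel.sub {I : Type v} [Preorder I] {e : E} {f : I → E} {x : E}
    (h : UConvergesRel e f x) : UConvergesRel e (fun p : I × I => f p.1 - f p.2) 0 := by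
  intro ε hε
  obtain ⟨i, hi⟩ := h (ε / 2) (half_pos hε)
  refine ⟨(i, i), fun p hp => ?_⟩
  calc |f p.1 - f p.2 - 0| = |(f p.1 - x) + -(f p.2 - x)| := by congr 1; abel
    _ ≤ |f p.1 - x| + |f p.2 - x| := by
      simpa only [abs_neg] using abs_add_le (f p.1 - x) (-(f p.2 - x))
    _ ≤ (ε / 2) • e + (ε / 2) • e := add_le_add (hi _ hp.1) (hi _ hp.2)
    _ = ε • e := by rw [← add_smul, add_halves]

theorem uniformAdherence_subset_uniformClosure (A : Set E) :
    uniformAdherence A ⊆ uniformClosure A := by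
  rintro x ⟨I, _, _, _, f, hf, hx⟩ C ⟨hC, hAC⟩
  exact hC I f x (fun i => hAC (hf i)) hx

end UniformLimits

namespace VectorSublattice

variable {E : Type u} [AddCommGroup E] [Lattice E] [Module ℝ E]

/-- Definitional, since `Y` inherits its order, absolute value and operations from `E`. -/
theorem uConvergesRel_iff (Y : VectorSublattice E) {I : Type v} [Preorder I] {e : Y} {f : I → Y}
    {y : Y} : UConvergesRel e f y ↔ UConvergesRel (e : E) (fun i => (f i : E)) (y : E) :=
  Iff.rfl

end VectorSublattice

/-! ### Binary expansions in the order completion -/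

namespace IsOrderCompletion

variable {X : Type u} [AddCommGroup X] [Lattice X] [IsOrderedAddMonoid X] [Module ℝ X]
  [IsOrderedModule ℝ X] {D : Type v} [AddCommGroup D] [Lattice D] [IsOrderedAddMonoid D]
  [Module ℝ D] [IsOrderedModule ℝ D] {J : X →ₗ[ℝ] D}

theorem map_le_map_iff (hJ : IsOrderCompletion J) {x y : X} : J x ≤ J y ↔ x ≤ y := by
  rw [← inf_eq_left, ← hJ.map_inf, hJ.injective.eq_iff, inf_eq_left]

theorem nonneg_iff (hJ : IsOrderCompletion J) {x : X} : 0 ≤ J x ↔ 0 ≤ x := by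
  rw [← map_zero J, hJ.map_le_map_iff]

/-- A positive element of the completion that dominates no non-zero positive element of `X` is
zero. -/
theorem eq_zero_of_forall_le (hJ : IsOrderCompletion J) {d : D} (hd : 0 ≤ d)
    (h : ∀ y : X, 0 ≤ y → J y ≤ d → y = 0) : d = 0 := by
  by_contra hne
  obtain ⟨y, hy, hyd⟩ := hJ.orderDense d (lt_of_le_of_ne hd (Ne.symm hne))
  rw [h y (hJ.nonneg_iff.1 hy.le) hyd, map_zero] at hy
  exact lt_irrefl _ hy

/-- By the projection property, a positive element of `X` splits into a part that is disjoint
from `w⁺` and a part that is disjoint from `w⁻`, for each `w` in the order completion. -/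
theorem exists_split (hJ : IsOrderCompletion J) (hPP : HasProjectionProperty X) {u : X}
    (hu : 0 ≤ u) (w : D) :
    ∃ p q : X, 0 ≤ p ∧ 0 ≤ q ∧ u = p + q ∧ w⁺ ⊓ J p = 0 ∧ w⁻ ⊓ J q = 0 := by
  -- `A` is the trace of `w⁺` on `X`; the band to project onto is its disjoint complement, so `p` is
  -- disjoint from `A` and `q` from everything disjoint from `A`.
  set A : Set X := {a | 0 ≤ a ∧ J a ≤ w⁺}
  obtain ⟨p, hp, q, hq, rfl⟩ := (hPP _ (isBand_disjointComplementSubmodule A)).2 u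
  have hqp : |q| ⊓ |p| = 0 := hq p hp
  have hp0 : 0 ≤ p := nonneg_of_disjoint_of_add_nonneg (inf_comm |q| |p| ▸ hqp) hu
  have hq0 : 0 ≤ q := nonneg_of_disjoint_of_add_nonneg hqp (add_comm p q ▸ hu)
  have hJp := hJ.nonneg_iff.2 hp0
  have hJq := hJ.nonneg_iff.2 hq0
  refine ⟨p, q, hp0, hq0, rfl, ?_, ?_⟩
  -- By order density it suffices to test elements of `X`: such a `y` lies in `A`, so it is disjoint
  -- from `p`, yet `y ≤ p`.
  · refine hJ.eq_zero_of_forall_le (le_inf (posPart_nonneg w) hJp) fun y hy hyd => ?_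
    have h := hp y ⟨hy, hyd.trans inf_le_left⟩
    rw [abs_of_nonneg hp0, abs_of_nonneg hy] at h
    rwa [inf_eq_right.2 (hJ.map_le_map_iff.1 (hyd.trans inf_le_right))] at h
  · refine hJ.eq_zero_of_forall_le (le_inf (negPart_nonneg w) hJq) fun y hy hyd => ?_
    -- Since `w⁺` and `w⁻` are disjoint, anything below `w⁻` is disjoint from `A`.
    have hyB : y ∈ disjointComplement A := by
      rintro a ⟨ha, haw⟩
      rw [abs_of_nonneg hy, abs_of_nonneg ha]
      refine le_antisymm (hJ.map_le_map_iff.1 ?_) (le_inf hy ha)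
      rw [hJ.map_inf, map_zero, ← posPart_inf_negPart_eq_zero w, inf_comm]
      exact inf_le_inf haw (hyd.trans inf_le_left)
    have h := hq y hyB
    rw [abs_of_nonneg hq0, abs_of_nonneg hy] at h
    rwa [inf_eq_right.2 (hJ.map_le_map_iff.1 (hyd.trans inf_le_right))] at h

/-- Extraction of one binary digit: the split of `u` by the sign of `J u - 2d` takes digit one on
`p` and zero on `q`. -/
theorem exists_two_smul_sub_mem_Icc (hJ : IsOrderCompletion J) (hPP : HasProjectionProperty X)
    {u : X} {d : D} (hd : d ∈ Set.Icc 0 (J u)) :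
    ∃ p : X, (2 : ℝ) • d - J p ∈ Set.Icc 0 (J u) := by
  obtain ⟨p, q, hp, hq, hpq, h1, h2⟩ :=
    hJ.exists_split hPP (hJ.nonneg_iff.1 (hd.1.trans hd.2)) (J u - (2 : ℝ) • d)
  have hJp := hJ.nonneg_iff.2 hp
  have hJq := hJ.nonneg_iff.2 hq
  have hu : J u = J p + J q := by rw [hpq, map_add]
  have hdd : (2 : ℝ) • d = d + d := two_smul ℝ d
  rw [hdd, hu] at h1 h2
  rw [hu] at hd ⊢
  -- The positive part is at most `J p + J q` and disjoint from `J p`, hence below `J q`; this is `J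
  -- p ≤ 2d`. Symmetrically, `h2'` gives `2d - J p ≤ J u`.
  have h1' : J p + J q - (d + d) ≤ J q := by
    refine (le_posPart _).trans (le_of_le_add_of_inf_eq_zero hJq (sup_le ?_ ?_) h1)
    · exact sub_le_self _ (add_nonneg hd.1 hd.1)
    · exact add_nonneg hJp hJq
  have h2' : -(J p + J q - (d + d)) ≤ J p := by
    refine (neg_le_negPart _).trans (le_of_le_add_of_inf_eq_zero hJp (sup_le ?_ ?_) h2)
    · rw [neg_sub, sub_le_iff_le_add, add_comm (J q)]
      exact add_le_add hd.2 hd.2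
    · exact add_nonneg hJq hJp
  refine ⟨p, ?_⟩
  rw [hdd]
  constructor
  · rw [sub_nonneg]
    rw [sub_le_iff_le_add, add_comm (J p), add_le_add_iff_left] at h1'
    exact h1'
  · rw [neg_sub, sub_le_iff_le_add] at h2'
    rw [sub_le_iff_le_add]
    rwa [add_comm (J p) (J p + J q)] at h2'

theorem exists_sub_mem_Icc (hJ : IsOrderCompletion J) (hPP : HasProjectionProperty X) {u : X}
    (n : ℕ) : ∀ d ∈ Set.Icc 0 (J u), ∃ x : X, (2 : ℝ) ^ n • (d - J x) ∈ Set.Icc 0 (J u) := by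
  induction n with
  | zero => exact fun d hd => ⟨0, by simpa using hd⟩
  | succ n ih =>
    intro d hd
    obtain ⟨p, hp⟩ := hJ.exists_two_smul_sub_mem_Icc hPP hd
    obtain ⟨x, hx⟩ := ih _ hp
    -- `x` approximates the remainder `2d - J p`, so `d` is approximated by half of `p + x`.
    refine ⟨(2 : ℝ)⁻¹ • (p + x), ?_⟩
    have e : (2 : ℝ) ^ (n + 1) • (d - J ((2 : ℝ)⁻¹ • (p + x))) =
        (2 : ℝ) ^ n • ((2 : ℝ) • d - J p - J x) := by
      rw [pow_succ, mul_smul, map_smul, smul_sub (2 : ℝ), smul_inv_smul₀ two_ne_zero, map_add,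
        sub_sub]
    rwa [e]

theorem uniformAdherence_range (hJ : IsOrderCompletion J) (hPP : HasProjectionProperty X) :
    uniformAdherence (Set.range J) = Set.univ := by
  refine Set.eq_univ_of_forall fun d => mem_uniformAdherence_iff_seq.2 ?_
  obtain ⟨v, hv⟩ := hJ.majorizing |d| (abs_nonneg d)
  -- Translation by `J v` moves `d ∈ [-J v, J v]` into a positive interval.
  have hd : d + J v ∈ Set.Icc 0 (J (v + v)) := by
    rw [map_add]
    exact ⟨neg_le_iff_add_nonneg'.1 ((neg_le_abs d).trans hv),
      add_le_add_left ((le_abs_self d).trans hv) _⟩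
  choose x hx using fun n => hJ.exists_sub_mem_Icc hPP n _ hd
  have hu : 0 ≤ J (v + v) := hd.1.trans hd.2
  refine ⟨fun n => J (x n - v), fun n => ⟨_, rfl⟩, J (v + v), hu, fun ε hε => ?_⟩
  obtain ⟨N, hN⟩ := exists_pow_lt_of_lt_one hε (show (2 : ℝ)⁻¹ < 1 by norm_num)
  refine ⟨N, fun n hn => ?_⟩
  have h2 : (0 : ℝ) < 2 ^ n := by positivity
  have e : d + J v - J (x n) = -(J (x n - v) - d) := by
    rw [map_sub]
    abel
  have h0 : 0 ≤ d + J v - J (x n) := by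
    have := smul_nonneg (inv_nonneg.2 h2.le) (hx n).1
    rwa [inv_smul_smul₀ h2.ne'] at this
  rw [← abs_neg, ← e, abs_of_nonneg h0]
  have h1 := smul_le_smul_of_nonneg_left (hx n).2 (inv_nonneg.2 h2.le)
  rw [inv_smul_smul₀ h2.ne', ← inv_pow] at h1
  refine h1.trans (smul_le_smul_of_nonneg_right ?_ hu)
  exact (pow_le_pow_of_le_one (by norm_num) (by norm_num) hn).trans hN.le

theorem uniformAdherence_subset_uniformCompletion (hJ : IsOrderCompletion J) :
    uniformAdherence (Set.range J) ⊆ uniformCompletion J := by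
  rintro d ⟨I, _, _, _, f, hf, e, -, hd⟩ _ ⟨Y, hY, hXY, rfl⟩
  -- The regulator `e` need not lie in `Y`; its majorant `J v` does, so the net is Cauchy in `Y`
  -- itself.
  obtain ⟨v, hv⟩ := hJ.majorizing |e| (abs_nonneg e)
  let g : I → Y := fun i => ⟨f i, hXY (hf i)⟩
  let r : Y := ⟨J v, hXY ⟨v, rfl⟩⟩
  have hr : 0 ≤ r := (abs_nonneg e).trans hv
  have hc : UCauchy g :=
    ⟨r, hr, Y.uConvergesRel_iff.2 (hd.mono ((le_abs_self e).trans hv)).sub⟩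
  obtain ⟨y, s, hs, hy⟩ := hY I g hc
  have hy' : UConverges f (y : D) := ⟨(s : D), hs, Y.uConvergesRel_iff.1 hy⟩
  have hd' : UConverges f d := ⟨J v, hr, hd.mono ((le_abs_self e).trans hv)⟩
  rw [hd'.unique hJ.orderComplete.isArchimedean hy']
  exact y.2

end IsOrderCompletion

end VecLat

/-- Let `X` be an Archimedean vector lattice with the projection property, and let `D`, with the
embedding `J : X → D`, be its order completion. Then the uniform adherence of `X` in `D` equals the
uniform closure of `X` in `D` and is all of `D`. In particular the uniform completion of `X` is
all of `D`. -/
theorem mainTheorem8 {X : Type u} [AddCommGroup X] [Lattice X] [IsOrderedAddMonoid X]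
    [Module ℝ X] [IsOrderedModule ℝ X] (hX : VecLat.IsArchimedean X)
    (hPP : VecLat.HasProjectionProperty X)
    {D : Type v} [AddCommGroup D] [Lattice D] [IsOrderedAddMonoid D]
    [Module ℝ D] [IsOrderedModule ℝ D] (J : X →ₗ[ℝ] D) (hJ : VecLat.IsOrderCompletion J) :
    VecLat.uniformAdherence (Set.range J) = VecLat.uniformClosure (Set.range J) ∧
      VecLat.uniformClosure (Set.range J) = Set.univ ∧
      VecLat.uniformCompletion J = Set.univ := by
  have had := hJ.uniformAdherence_range hPP
  have hcl : VecLat.uniformClosure (Set.range J) = Set.univ :=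
    Set.univ_subset_iff.1 (had ▸ VecLat.uniformAdherence_subset_uniformClosure _)
  exact ⟨had.trans hcl.symm, hcl,
    Set.univ_subset_iff.1 (had ▸ hJ.uniformAdherence_subset_uniformCompletion)⟩
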